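/- Let $R$ be an associative ring with unity; all modules are left $R$-modules and $\|A\|$ denotes the cardinality of $A$. Definitions. An injective homomorphism $f:A\to B$ is an RD-embedding if $f[A]\cap rB=rf[A]$ for every $r\in R$. It is a pure embedding if every finite system of $R$-linear equations with parameters in $f[A]$ that has a solution in $B$ has a solution in $f[A]$. A module $E$ is RD-injective (pure-injective) if for every RD-embedding (pure embedding) $f:A\to B$ and every homomorphism $g:A\to E$ there is a homomorphism $h:B\to E$ with $h\circ f=g$. A module $C$ is cotorsion if $\operatorname{Ext}^1_R(G,C)=0$ for every flat module $G$. For a module $M$, let $\mathfrak{s}(M)$ be the kernel of the map $M\cong R\otimes_R M\to I\otimes_R M$, where $R\to I$ is an embedding of the right module $R_R$ into an injective right module, for instance its injective envelope (the kernel does not depend on the choice); $M$ is $\mathfrak{s}$-torsion if $\mathfrak{s}(M)=M$. An $\mathfrak{s}$-torsion module $T$ is $K^{\mathfrak{s}\text{-Tor}}$-pure-injective if for every pure embedding $f:A\to B$ between $\mathfrak{s}$-torsion modules and every homomorphism $g:A\to T$ there is a homomorphism $h:B\to T$ with $h\circ f=g$. Then: 1. A module $E$ is injective if and only if for every embedding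 $f:A\to B$ with $\|A\|,\|B\|\le \operatorname{card}(R)+\aleph_0$ and every homomorphism $g:A\to E$ there is a homomorphism $h:B\to E$ with $h\circ f=g$. 2. A module $E$ is RD-injective if and only if for every RD-embedding $f:A\to B$ with $\|A\|,\|B\|\le \operatorname{card}(R)+\aleph_0$ and every homomorphism $g:A\to E$ there is a homomorphism $h:B\to E$ with $h\circ f=g$. 3. A module $E$ is pure-injective if and only if for every pure embedding $f:A\to B$ with $\|A\|,\|B\|\le \operatorname{card}(R)+\aleph_0$ and every homomorphism $g:A\to E$ there is a homomorphism $h:B\to E$ with $h\circ f=g$. 4. Let $F$ be a flat module. $F$ is cotorsion if and only if for every pure embedding $f:A\to B$ with $A,B$ flat and $\|A\|,\|B\|\le \operatorname{card}(R)+\aleph_0$ and every homomorphism $g:A\to F$ there is a homomorphism $h:B\to F$ with $h\circ f=g$. 5. Let $T$ be an $\mathfrak{s}$-torsion module. $T$ is $K^{\mathfrak{s}\text{-Tor}}$-pure-injective if and only if for every pure embedding $f:A\to B$ with $A,B$ $\mathfrak{s}$-torsion and $\|A\|,\|B\|\le \operatorname{card}(R)+\aleph_0$ and every homomorphism $g:A\to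 T$ there is a homomorphism $h:B\to T$ with $h\circ f=g$. -/

import Mathlib

open scoped TensorProduct MulOpposite Cardinal

universe u v w

/-!
Modules over an associative unital ring `R`, not assumed commutative. Left modules are
`Module R M`, right modules are `Module Rᵐᵒᵖ X`, with `x · r = MulOpposite.op r • x`.
-/

namespace RelInj

/-! ### Embeddings of left modules -/

section Embeddings

variable {R : Type u} [Ring R] {A : Type v} {B : Type w} [AddCommGroup A] [AddCommGroup B]
  [Module R A] [Module R B]

/-- `f : A → B` is an RD-embedding: it is injective and `f[A] ∩ rB = r f[A]` for all `r ∈ R`. -/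
def IsRDEmbedding (f : A →ₗ[R] B) : Prop :=
  Function.Injective f ∧
    ∀ r : R, Set.range f ∩ Set.range (fun b : B => r • b) =
      (fun b : B => r • b) '' Set.range f

/-- `f : A → B` is a pure embedding: it is injective and every finite system of linear equations
`∑ j, r i j • x j = f (a i)`, `i < m`, in `n` unknowns with parameters in `f[A]` that has a
solution in `B` has a solution in `f[A]`. -/
def IsPureEmbedding (f : A →ₗ[R] B) : Prop :=
  Function.Injective f ∧
    ∀ (m n : ℕ) (r : Fin m → Fin n → R) (a : Fin m → A),
      (∃ x : Fin n → B, ∀ i, ∑ j, r i j • x j = f (a i)) →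
        ∃ y : Fin n → A, ∀ i, ∑ j, r i j • f (y j) = f (a i)

end Embeddings

/-! ### The tensor product of a right and a left module, flat modules -/

section Tensor

variable (R : Type u) [Ring R]

/-- The relations `(x · r) ⊗ m = x ⊗ (r m)`. -/
def balancedRel (X : Type v) [AddCommGroup X] [Module Rᵐᵒᵖ X]
    (M : Type w) [AddCommGroup M] [Module R M] : Submodule ℤ (X ⊗[ℤ] M) :=
  Submodule.span ℤ {t | ∃ (x : X) (r : R) (m : M),
    t = (MulOpposite.op r • x) ⊗ₜ[ℤ] m - x ⊗ₜ[ℤ] (r • m)}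

/-- The abelian group `X ⊗_R M`, for a right module `X` and a left module `M`. -/
abbrev BalancedTensor (X : Type v) [AddCommGroup X] [Module Rᵐᵒᵖ X]
    (M : Type w) [AddCommGroup M] [Module R M] : Type (max v w) :=
  (X ⊗[ℤ] M) ⧸ balancedRel R X M

/-- The pure tensor `x ⊗ m` in `X ⊗_R M`. -/
def btmul {X : Type v} [AddCommGroup X] [Module Rᵐᵒᵖ X]
    {M : Type w} [AddCommGroup M] [Module R M] (x : X) (m : M) : BalancedTensor R X M :=
  (balancedRel R X M).mkQ (x ⊗ₜ[ℤ] m)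

variable {R}

lemma balancedRel_le_comap {X Y : Type v} [AddCommGroup X] [Module Rᵐᵒᵖ X] [AddCommGroup Y]
    [Module Rᵐᵒᵖ Y] (φ : X →ₗ[Rᵐᵒᵖ] Y) (M : Type w) [AddCommGroup M] [Module R M] :
    balancedRel R X M ≤
      (balancedRel R Y M).comap (φ.toAddMonoidHom.toIntLinearMap.rTensor M) := by
  refine Submodule.span_le.2 ?_
  rintro _ ⟨x, r, m, rfl⟩
  refine Submodule.subset_span ⟨φ x, r, m, ?_⟩
  simp

/-- The homomorphism `φ ⊗_R M : X ⊗_R M → Y ⊗_R M` induced by a homomorphism `φ : X → Y` of right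
modules; it maps `x ⊗ m` to `φ x ⊗ m`. -/
def btmap {X Y : Type v} [AddCommGroup X] [Module Rᵐᵒᵖ X] [AddCommGroup Y]
    [Module Rᵐᵒᵖ Y] (φ : X →ₗ[Rᵐᵒᵖ] Y) (M : Type w) [AddCommGroup M] [Module R M] :
    BalancedTensor R X M →ₗ[ℤ] BalancedTensor R Y M :=
  (balancedRel R X M).mapQ (balancedRel R Y M) (φ.toAddMonoidHom.toIntLinearMap.rTensor M)
    (balancedRel_le_comap φ M)

lemma btmap_btmul {X Y : Type v} [AddCommGroup X] [Module Rᵐᵒᵖ X] [AddCommGroup Y]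
    [Module Rᵐᵒᵖ Y] (φ : X →ₗ[Rᵐᵒᵖ] Y) {M : Type w} [AddCommGroup M] [Module R M]
    (x : X) (m : M) : btmap φ M (btmul R x m) = btmul R (φ x) m := by
  rfl

variable (R)

/-- The left module `M` is flat: `- ⊗_R M` preserves injectivity of homomorphisms of right
modules. -/
def IsFlat (M : Type w) [AddCommGroup M] [Module R M] : Prop :=
  ∀ (X Y : Type u) [AddCommGroup X] [Module Rᵐᵒᵖ X] [AddCommGroup Y] [Module Rᵐᵒᵖ Y]
    (φ : X →ₗ[Rᵐᵒᵖ] Y), Function.Injective φ → Function.Injective (btmap φ M)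

/-! ### The torsion submodule `𝔰(M)` -/

/-- The `𝔰`-torsion elements of `M`: the kernel of `M ≅ R ⊗_R M → I ⊗_R M`, where `R → I` is an
embedding of the right module `R` into an injective right module (for instance into its injective
envelope). In other words, the value at `R` of the injective stabilization of `- ⊗_R M`. It does
not depend on the embedding, see `mem_sTorsion_iff`. -/
def sTorsion (M : Type w) [AddCommGroup M] [Module R M] : Set M :=
  {m | ∀ (I : Type u) [AddCommGroup I] [Module Rᵐᵒᵖ I], Module.Injective Rᵐᵒᵖ I →
    ∀ j : R →ₗ[Rᵐᵒᵖ] I, Function.Injective j → btmap j M (btmul R (1 : R) m) = 0}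

/-- A single embedding of `R` into an injective right module computes the torsion. -/
lemma mem_sTorsion_iff {M : Type w} [AddCommGroup M] [Module R M] (m : M)
    {I : Type u} [AddCommGroup I] [Module Rᵐᵒᵖ I] (_hI : Module.Injective Rᵐᵒᵖ I)
    (j : R →ₗ[Rᵐᵒᵖ] I) (hj : Function.Injective j) :
    m ∈ sTorsion R M ↔ btmap j M (btmul R (1 : R) m) = 0 := by
  refine ⟨fun h => h I _hI j hj, fun h I' _ _ hI' j' _ => ?_⟩
  obtain ⟨φ, hφ⟩ := hI'.out j hj j'
  have h2 := congrArg (btmap φ M) h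
  rw [map_zero, btmap_btmul, btmap_btmul, hφ] at h2
  rw [btmap_btmul, h2]

/-- `M` is an `𝔰`-torsion module: `𝔰(M) = M`. -/
def IsSTorsion (M : Type w) [AddCommGroup M] [Module R M] : Prop :=
  sTorsion R M = Set.univ

end Tensor

/-! ### Relative injectivity -/

section Injectivity

variable (R : Type u) [Ring R]

/-- RD-injective modules: injective with respect to all RD-embeddings. -/
def IsRDInjective (E : Type w) [AddCommGroup E] [Module R E] : Prop :=
  ∀ (A B : Type w) [AddCommGroup A] [AddCommGroup B] [Module R A] [Module R B]
    (f : A →ₗ[R] B), IsRDEmbedding f → ∀ g : A →ₗ[R] E, ∃ h : B →ₗ[R] E, h ∘ₗ f = g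

/-- Pure-injective modules: injective with respect to all pure embeddings. -/
def IsPureInjective (E : Type w) [AddCommGroup E] [Module R E] : Prop :=
  ∀ (A B : Type w) [AddCommGroup A] [AddCommGroup B] [Module R A] [Module R B]
    (f : A →ₗ[R] B), IsPureEmbedding f → ∀ g : A →ₗ[R] E, ∃ h : B →ₗ[R] E, h ∘ₗ f = g

/-- Cotorsion modules: `Ext¹_R(G, C) = 0` for every flat module `G`. -/
def IsCotorsion [Small.{w} R] (C : Type w) [AddCommGroup C] [Module R C] : Prop :=
  ∀ (G : Type w) [AddCommGroup G] [Module R G], IsFlat R G →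
    Subsingleton (CategoryTheory.Abelian.Ext (ModuleCat.of R G) (ModuleCat.of R C) 1)

/-- Pure-injective modules relative to the class of `𝔰`-torsion modules: the `𝔰`-torsion modules
that are injective with respect to all pure embeddings between `𝔰`-torsion modules. -/
def IsSTorPureInjective (T : Type w) [AddCommGroup T] [Module R T] : Prop :=
  IsSTorsion R T ∧
    ∀ (A B : Type w) [AddCommGroup A] [AddCommGroup B] [Module R A] [Module R B],
      IsSTorsion R A → IsSTorsion R B → ∀ f : A →ₗ[R] B, IsPureEmbedding f →
        ∀ g : A →ₗ[R] T, ∃ h : B →ₗ[R] T, h ∘ₗ f = g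

end Injectivity

end RelInj

open RelInj

/-! All five statements are instances of one extension principle, `exists_extension_of_small`. It
concerns embeddings that reflect solvability of the linear systems of prescribed shapes `P`: no
shape gives all embeddings, one equation in one unknown gives RD-embeddings, all shapes give pure
embeddings. The modules range over a class closed under such submodules: all modules, flat modules,
or `𝔰`-torsion modules.

By Zorn's lemma, `g` has a maximal extension to a `P`-pure submodule `C` of `B`. If `b ∉ C`, a
Löwenheim–Skolem closure (`exists_small_solution_closed`) gives a small `N` containing `b` such that
`N` and `C + N` are `P`-pure in `B` and `C ∩ N` is `P`-pure in `N`. Small injectivity extends the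
map from `C ∩ N` to `N`; gluing over `C ∩ N` defines it on `C + N`, contradicting maximality.

It remains to see that flatness and `𝔰`-torsion pass to pure submodules, which holds because
vanishing in a tensor product is witnessed by linear equations (`exists_of_tensorOfTuple_eq_zero`),
and that cotorsion means extending maps along pure embeddings into flat modules
(`isCotorsion_iff_exists_extension`). -/

namespace RelInj

/-! ### Small submodules closed under solutions of linear systems -/

section Closure

variable (R : Type u)

/-- The language with a symbol for every linear combination, and with two families of Skolem
functions for the solutions of finite systems of linear equations. -/
def solLanguage : FirstOrder.Language.{u, 0} where
  Functions k := (Fin k → R) ⊕ ((Σ n : ℕ, (Fin k → Fin n → R) × Fin n) ⊕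
    (Σ n : ℕ, (Fin k → Fin n → R) × Fin n))
  Relations _ := Empty

lemma card_solLanguage_functions_le :
    #(Σ k, (solLanguage R).Functions k) ≤ #R + ℵ₀ := by
  set κ : Cardinal.{u} := #R + ℵ₀ with hκ
  have hω : ℵ₀ ≤ κ := self_le_add_left _ _
  have hR : #R ≤ κ := self_le_add_right _ _
  have hpow : ∀ k : ℕ, #(Fin k → R) ≤ κ := fun k => by
    calc #(Fin k → R) = #R ^ k := by simp
      _ ≤ κ ^ k := by gcongr
      _ ≤ κ := Cardinal.power_nat_le hω
  have hpow2 : ∀ k n : ℕ, #(Fin k → Fin n → R) ≤ κ := fun k n => by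
    calc #(Fin k → Fin n → R) = #(Fin n → R) ^ k := by simp
      _ ≤ κ ^ k := by gcongr; exact hpow n
      _ ≤ κ := Cardinal.power_nat_le hω
  have hsum : ∀ G : ℕ → Type u, (∀ n, #(G n) ≤ κ) → #(Σ n, G n) ≤ κ := fun G hG => by
    rw [Cardinal.mk_sigma]
    refine (Cardinal.sum_le_sum _ (fun _ => κ) hG).trans ?_
    rw [Cardinal.sum_const]
    exact Cardinal.mul_le_of_le hω (by simpa using hω) (by simp)
  have hsys : ∀ k : ℕ, #(Σ n : ℕ, (Fin k → Fin n → R) × Fin n) ≤ κ := fun k => by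
    refine hsum _ fun n => ?_
    rw [Cardinal.mk_prod]
    refine Cardinal.mul_le_of_le hω ?_ ?_
    · simpa using hpow2 k n
    · exact (by simpa using (Cardinal.natCast_lt_aleph0 (n := n)).le.trans hω)
  refine hsum _ fun k => ?_
  simp only [solLanguage]
  rw [Cardinal.mk_sum, Cardinal.mk_sum, Cardinal.lift_id, Cardinal.lift_id, Cardinal.lift_id]
  exact Cardinal.add_le_of_le hω (hpow k) (Cardinal.add_le_of_le hω (hsys k) (hsys k))

variable {R} [Ring R] {B : Type (max u v)} [AddCommGroup B] [Module R B]

/-- Given a submodule `C`, every element lies in a submodule `N` with at most `#R + ℵ₀` elements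
that contains solutions of all finite systems with parameters in `N` that are solvable modulo `C`,
respectively in `C`. -/
lemma exists_small_solution_closed (C : Submodule R B) (b : B) :
    ∃ N : Submodule R B, b ∈ N ∧ #N ≤ Cardinal.lift.{v} #R + ℵ₀ ∧
      (∀ (m n : ℕ) (r : Fin m → Fin n → R) (s : Fin m → B), (∀ i, s i ∈ N) →
        (∃ x : Fin n → B, ∀ i, ∑ j, r i j • x j - s i ∈ C) →
        ∃ x : Fin n → B, (∀ j, x j ∈ N) ∧ ∀ i, ∑ j, r i j • x j - s i ∈ C) ∧
      (∀ (m n : ℕ) (r : Fin m → Fin n → R) (s : Fin m → B), (∀ i, s i ∈ N) →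
        (∃ x : Fin n → B, (∀ j, x j ∈ C) ∧ ∀ i, ∑ j, r i j • x j = s i) →
        ∃ x : Fin n → B, (∀ j, x j ∈ N ∧ x j ∈ C) ∧ ∀ i, ∑ j, r i j • x j = s i) := by
  classical
  -- The value 0 on unsolvable systems only makes the Skolem functions total.
  let w₁ : ∀ (m n : ℕ) (r : Fin m → Fin n → R) (s : Fin m → B), Fin n → B := fun m n r s =>
    if h : ∃ x : Fin n → B, ∀ i, ∑ j, r i j • x j - s i ∈ C then h.choose else 0
  let w₂ : ∀ (m n : ℕ) (r : Fin m → Fin n → R) (s : Fin m → B), Fin n → B := fun m n r s =>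
    if h : ∃ x : Fin n → B, (∀ j, x j ∈ C) ∧ ∀ i, ∑ j, r i j • x j = s i then h.choose else 0
  let : (solLanguage R).Structure B :=
    { funMap := fun {k} f s => match f with
        | Sum.inl c => ∑ i, c i • s i
        | Sum.inr (Sum.inl t) => w₁ k t.1 t.2.1 s t.2.2
        | Sum.inr (Sum.inr t) => w₂ k t.1 t.2.1 s t.2.2
      RelMap := fun r _ => r.elim }
  let S := FirstOrder.Language.Substructure.closure (solLanguage R) ({b} : Set B)
  have hlin : ∀ {k : ℕ} (c : Fin k → R) (s : Fin k → B), (∀ i, s i ∈ S) → ∑ i, c i • s i ∈ S :=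
    fun c s hs => S.fun_mem (Sum.inl c) s hs
  have h₁ : ∀ (m n : ℕ) (r : Fin m → Fin n → R) (s : Fin m → B), (∀ i, s i ∈ S) →
      ∀ j, w₁ m n r s j ∈ S :=
    fun m n r s hs j => S.fun_mem (Sum.inr (Sum.inl ⟨n, r, j⟩)) s hs
  have h₂ : ∀ (m n : ℕ) (r : Fin m → Fin n → R) (s : Fin m → B), (∀ i, s i ∈ S) →
      ∀ j, w₂ m n r s j ∈ S :=
    fun m n r s hs j => S.fun_mem (Sum.inr (Sum.inr ⟨n, r, j⟩)) s hs
  -- The linear combinations in the language make every substructure a submodule; the empty one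
  -- supplies 0.
  let N : Submodule R B :=
    { carrier := S
      zero_mem' := by simpa using hlin (k := 0) Fin.elim0 Fin.elim0 (fun i => i.elim0)
      add_mem' := fun {x y} hx hy => by
        simpa [Fin.sum_univ_two] using hlin ![(1 : R), 1] ![x, y] (by
          intro i; fin_cases i <;> simpa)
      smul_mem' := fun c x hx => by
        simpa using hlin ![c] ![x] (by intro i; fin_cases i; simpa) }
  refine ⟨N, FirstOrder.Language.Substructure.subset_closure (Set.mem_singleton b), ?_, ?_, ?_⟩
  · have h := FirstOrder.Language.Substructure.lift_card_closure_le (L := solLanguage R)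
      (s := ({b} : Set B))
    have hc : Cardinal.lift.{max u v, u} #(Σ k, (solLanguage R).Functions k) ≤
        Cardinal.lift.{v} #R + ℵ₀ := by
      have := Cardinal.lift_le.{max u v}.2 (card_solLanguage_functions_le R)
      rw [Cardinal.lift_add, Cardinal.lift_aleph0, Cardinal.lift_umax.{u, v}] at this
      rwa [Cardinal.lift_umax.{u, v}]
    have hω : (ℵ₀ : Cardinal.{max u v}) ≤ Cardinal.lift.{v} #R + ℵ₀ := self_le_add_left _ _
    have h' : #N ≤ max ℵ₀ (1 + Cardinal.lift.{max u v, u} #(Σ k, (solLanguage R).Functions k)) := by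
      rw [Cardinal.lift_id'.{u, max u v}, Cardinal.mk_singleton, Cardinal.lift_one] at h
      exact h
    refine h'.trans (max_le hω (Cardinal.add_le_of_le hω ?_ hc))
    exact Cardinal.one_le_aleph0.trans hω
  · intro m n r s hs hx
    refine ⟨w₁ m n r s, h₁ m n r s hs, ?_⟩
    simp only [w₁, dif_pos hx]
    exact hx.choose_spec
  · intro m n r s hs hx
    have e : w₂ m n r s = hx.choose := dif_pos hx
    refine ⟨w₂ m n r s, fun j => ⟨h₂ m n r s hs j, ?_⟩, ?_⟩
    · rw [e]; exact hx.choose_spec.1 j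
    · rw [e]; exact hx.choose_spec.2

end Closure

/-! ### Relative purity and the extension principle -/

section RelPure

variable {R : Type u} [Ring R]

/-- Embeddings that reflect solvability of the systems of linear equations whose numbers of
equations and of unknowns satisfy `P`. -/
def IsRelPure (P : ℕ → ℕ → Prop) {A : Type v} {B : Type w} [AddCommGroup A] [AddCommGroup B]
    [Module R A] [Module R B] (f : A →ₗ[R] B) : Prop :=
  Function.Injective f ∧ ∀ m n : ℕ, P m n → ∀ (r : Fin m → Fin n → R) (a : Fin m → A),
    (∃ x : Fin n → B, ∀ i, ∑ j, r i j • x j = f (a i)) →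
      ∃ y : Fin n → A, ∀ i, ∑ j, r i j • y j = a i

/-- The submodules whose inclusion reflects solvability of the systems of shape `P`. -/
def IsRelPureSubmodule (P : ℕ → ℕ → Prop) {B : Type w} [AddCommGroup B] [Module R B]
    (C : Submodule R B) : Prop :=
  ∀ m n : ℕ, P m n → ∀ (r : Fin m → Fin n → R) (a : Fin m → B), (∀ i, a i ∈ C) →
    (∃ x : Fin n → B, ∀ i, ∑ j, r i j • x j = a i) →
      ∃ y : Fin n → B, (∀ j, y j ∈ C) ∧ ∀ i, ∑ j, r i j • y j = a i

variable {P : ℕ → ℕ → Prop}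

lemma IsRelPure.range {A : Type v} {B : Type w} [AddCommGroup A] [AddCommGroup B]
    [Module R A] [Module R B] {f : A →ₗ[R] B} (hf : IsRelPure P f) :
    IsRelPureSubmodule P (LinearMap.range f) := by
  intro m n hP r a ha hx
  choose a' ha' using ha
  obtain ⟨y, hy⟩ := hf.2 m n hP r a' (by simpa [ha'] using hx)
  refine ⟨fun j => f (y j), fun j => ⟨y j, rfl⟩, fun i => ?_⟩
  rw [← ha', ← hy, map_sum]
  simp

lemma isRelPure_inclusion {B : Type w} [AddCommGroup B] [Module R B] {C D : Submodule R B}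
    (hCD : C ≤ D)
    (h : ∀ m n : ℕ, P m n → ∀ (r : Fin m → Fin n → R) (a : Fin m → B), (∀ i, a i ∈ C) →
      (∃ x : Fin n → B, (∀ j, x j ∈ D) ∧ ∀ i, ∑ j, r i j • x j = a i) →
      ∃ y : Fin n → B, (∀ j, y j ∈ C) ∧ ∀ i, ∑ j, r i j • y j = a i) :
    IsRelPure P (Submodule.inclusion hCD) := by
  refine ⟨Submodule.inclusion_injective hCD, fun m n hP r a ⟨x, hx⟩ => ?_⟩
  obtain ⟨y, hyC, hy⟩ := h m n hP r (fun i => a i) (fun i => (a i).2)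
    ⟨fun j => x j, fun j => (x j).2, fun i => by
      simpa using congrArg (Subtype.val : D → B) (hx i)⟩
  refine ⟨fun j => ⟨y j, hyC j⟩, fun i => Subtype.ext ?_⟩
  simpa using hy i

lemma IsRelPureSubmodule.isRelPure_subtype {B : Type w} [AddCommGroup B] [Module R B]
    {C : Submodule R B} (hC : IsRelPureSubmodule P C) : IsRelPure P C.subtype := by
  refine ⟨C.injective_subtype, fun m n hP r a hx => ?_⟩
  obtain ⟨y, hyC, hy⟩ := hC m n hP r (fun i => a i) (fun i => (a i).2) hx
  refine ⟨fun j => ⟨y j, hyC j⟩, fun i => Subtype.ext ?_⟩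
  simpa using hy i

/-- A system has finitely many parameters, so directedness puts them all in one member of the
family, where the system can be solved. -/
lemma isRelPureSubmodule_sSup {B : Type w} [AddCommGroup B] [Module R B]
    {c : Set (Submodule R B)} (hne : c.Nonempty) (hdir : DirectedOn (· ≤ ·) c)
    (h : ∀ C ∈ c, IsRelPureSubmodule P C) : IsRelPureSubmodule P (sSup c) := by
  intro m n hP r a ha hx
  have key : ∀ k : ℕ, ∀ a : Fin k → B, (∀ i, a i ∈ sSup c) → ∃ C ∈ c, ∀ i, a i ∈ C := by
    intro k
    induction k with
    | zero => exact fun a _ => ⟨hne.some, hne.some_mem, fun i => i.elim0⟩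
    | succ k ih =>
      intro a ha
      obtain ⟨C, hC, h1⟩ := ih (fun i => a i.succ) (fun i => ha _)
      obtain ⟨D, hD, h2⟩ := (Submodule.mem_sSup_of_directed hne hdir).1 (ha 0)
      obtain ⟨U, hU, hCU, hDU⟩ := hdir C hC D hD
      exact ⟨U, hU, fun i => Fin.cases (hDU h2) (fun i => hCU (h1 i)) i⟩
  obtain ⟨C, hC, haC⟩ := key m a ha
  obtain ⟨y, hyC, hy⟩ := h C hC m n hP r a haC hx
  exact ⟨y, fun j => le_sSup hC (hyC j), hy⟩

/-- A module is injective relative to the `P`-pure embeddings into modules of a class `K` that is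
closed under `P`-pure submodules as soon as it is so relative to the embeddings between modules
with at most `#R + ℵ₀` elements. -/
theorem exists_extension_of_small (P : ℕ → ℕ → Prop)
    (K : ∀ (M : Type (max u v)) [AddCommGroup M] [Module R M], Prop)
    (hK : ∀ (A B : Type (max u v)) [AddCommGroup A] [AddCommGroup B] [Module R A] [Module R B]
      (f : A →ₗ[R] B), IsRelPure P f → K B → K A)
    (E : Type (max u v)) [AddCommGroup E] [Module R E]
    (hE : ∀ (A B : Type (max u v)) [AddCommGroup A] [AddCommGroup B] [Module R A] [Module R B],
      K A → K B → ∀ f : A →ₗ[R] B, IsRelPure P f →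
        #A ≤ Cardinal.lift.{v} #R + ℵ₀ → #B ≤ Cardinal.lift.{v} #R + ℵ₀ →
        ∀ g : A →ₗ[R] E, ∃ h : B →ₗ[R] E, h ∘ₗ f = g)
    (A B : Type (max u v)) [AddCommGroup A] [AddCommGroup B] [Module R A] [Module R B]
    (hB : K B) (f : A →ₗ[R] B) (hf : IsRelPure P f) (g : A →ₗ[R] E) :
    ∃ h : B →ₗ[R] E, h ∘ₗ f = g := by
  let p₀ : B →ₗ.[R] E :=
    ⟨LinearMap.range f, g ∘ₗ (LinearEquiv.ofInjective f hf.1).symm.toLinearMap⟩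
  obtain ⟨p, hp₀, hp⟩ := zorn_le_nonempty₀
    {p : B →ₗ.[R] E | IsRelPureSubmodule P p.domain} (by
      intro c hcS hc y hy
      refine ⟨LinearPMap.sSup c hc.directedOn, ?_, fun z hz => LinearPMap.le_sSup _ hz⟩
      refine isRelPureSubmodule_sSup (Set.Nonempty.image _ ⟨y, hy⟩) ?_ ?_
      · refine (hc.directedOn).mono_comp ?_
        exact fun _ _ h => h.1
      · rintro _ ⟨q, hq, rfl⟩
        exact hcS hq) p₀ hf.range
  have hpC : IsRelPureSubmodule P p.domain := hp.prop
  have htop : p.domain = ⊤ := by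
    by_contra hne
    obtain ⟨b, -, hb⟩ := SetLike.exists_of_lt (lt_top_iff_ne_top.2 hne)
    set C := p.domain with hC
    obtain ⟨N, hbN, hcard, h₁, h₂⟩ := exists_small_solution_closed.{u, v} C b
    -- Solve modulo `C` inside `N`. The defect lies in `C ∩ N` and its system is solvable in `B`,
    -- hence in `C` by purity and in `C ∩ N` by closure; subtracting that solution removes the
    -- defect.
    have hNpure : IsRelPureSubmodule P N := by
      rintro m n hP r a ha ⟨x, hx⟩
      obtain ⟨x', hx'N, hx'⟩ := h₁ m n r a ha ⟨x, fun i => by simp [hx i]⟩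
      have hN' : ∀ i, ∑ j, r i j • x' j - a i ∈ N := fun i =>
        N.sub_mem (N.sum_mem fun j _ => N.smul_mem _ (hx'N j)) (ha i)
      obtain ⟨y, hy⟩ := h₂ m n r _ hN' (hpC m n hP r _ hx' ⟨x' - x, fun i => by
        simp [smul_sub, hx i]⟩)
      refine ⟨x' - y, fun j => N.sub_mem (hx'N j) (hy.1 j).1, fun i => ?_⟩
      simp [smul_sub, hy.2 i]
    have hincl : IsRelPure P (Submodule.inclusion (inf_le_right : C ⊓ N ≤ N)) := by
      refine isRelPure_inclusion _ ?_
      rintro m n hP r a ha ⟨x, -, hx⟩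
      obtain ⟨y, hy, hy'⟩ := h₂ m n r a (fun i => (ha i).2)
        (hpC m n hP r a (fun i => (ha i).1) ⟨x, hx⟩)
      exact ⟨y, fun j => ⟨(hy j).2, (hy j).1⟩, hy'⟩
    -- Split the parameters as `c + d`. Solving for `d` modulo `C` within `N` leaves a system with
    -- parameters in `C`, solvable in `B` and so in `C`.
    have hsup : IsRelPureSubmodule P (C ⊔ N) := by
      rintro m n hP r a ha ⟨x, hx⟩
      choose c hc d hd hcd using fun i => Submodule.mem_sup.1 (ha i)
      obtain ⟨x', hx'N, hx'⟩ := h₁ m n r d hd ⟨x, fun i => by simp [hx i, ← hcd i, hc i]⟩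
      obtain ⟨y, hyC, hy⟩ := hpC m n hP r (fun i => c i - (∑ j, r i j • x' j - d i))
        (fun i => C.sub_mem (hc i) (hx' i)) ⟨x - x', fun i => by
          simp only [Pi.sub_apply, smul_sub, Finset.sum_sub_distrib, hx i, ← hcd i]; abel⟩
      refine ⟨y + x', fun j => Submodule.add_mem_sup (hyC j) (hx'N j), fun i => ?_⟩
      simp only [Pi.add_apply, smul_add, Finset.sum_add_distrib, hy i, ← hcd i]; abel
    have hKN : K N := hK _ _ _ hNpure.isRelPure_subtype hB
    have hcard' : #(C ⊓ N : Submodule R B) ≤ Cardinal.lift.{v} #R + ℵ₀ :=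
      (Cardinal.mk_le_of_injective (Submodule.inclusion_injective
        (inf_le_right : C ⊓ N ≤ N))).trans hcard
    obtain ⟨h, hh⟩ := hE _ _ (hK _ _ _ hincl hKN) hKN _ hincl hcard' hcard
      (p.toFun ∘ₗ Submodule.inclusion (inf_le_left : C ⊓ N ≤ C))
    let q : B →ₗ.[R] E := ⟨N, h⟩
    have hcompat : ∀ (x : p.domain) (y : q.domain), (x : B) = y → p x = q y := by
      rintro ⟨x, hx⟩ ⟨y, hy⟩ (rfl : x = y)
      exact (LinearMap.congr_fun hh ⟨x, hx, hy⟩).symm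
    have hle := hp.le_of_ge (y := p.sup q hcompat) hsup (LinearPMap.left_le_sup _ _ _)
    exact hb (hle.1 (Submodule.mem_sup_right hbN))
  refine ⟨p.toFun ∘ₗ LinearMap.codRestrict p.domain LinearMap.id (fun x => by simp [htop]), ?_⟩
  ext a
  have h1 := hp₀.2 (x := ⟨f a, a, rfl⟩) (y := ⟨f a, by simp [htop]⟩) rfl
  have h2 : p₀ ⟨f a, a, rfl⟩ = g a := by
    change g ((LinearEquiv.ofInjective f hf.1).symm ⟨f a, a, rfl⟩) = g a
    congr 1
    rw [LinearEquiv.symm_apply_eq]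
    rfl
  rw [← h2, h1]
  rfl

end RelPure

end RelInj
namespace RelInj

/-! ### Vanishing of elements of a tensor product -/

section Vanishing

variable {R : Type u} [Ring R]

/-- The tuple `(k i • m)_i`. -/
noncomputable def smulTuple {ι : Type*} {M : Type*} [AddCommGroup M] [Module R M] :
    (ι →₀ R) →+ M →+ (ι →₀ M) where
  toFun k :=
    { toFun := fun m => k.mapRange (fun r => r • m) (zero_smul R m)
      map_zero' := by ext; simp
      map_add' := fun a b => by ext; simp }
  map_zero' := by ext; simp
  map_add' a b := by ext; simp [add_smul]

lemma smulTuple_apply {ι : Type*} {M : Type*} [AddCommGroup M] [Module R M] (k : ι →₀ R) (m : M)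
    (i : ι) : smulTuple k m i = k i • m := rfl

/-- The homomorphism `(m_i)_i ↦ ∑ i, π (e_i) ⊗ m_i`. -/
noncomputable def tensorOfTuple {ι : Type u} {Y : Type u} [AddCommGroup Y] [Module Rᵐᵒᵖ Y]
    (π : (ι →₀ R) →ₗ[Rᵐᵒᵖ] Y) (M : Type w) [AddCommGroup M] [Module R M] :
    (ι →₀ M) →+ BalancedTensor R Y M :=
  Finsupp.liftAddHom fun i =>
    { toFun := fun m => btmul R (π (Finsupp.single i 1)) m
      map_zero' := by simp [btmul]
      map_add' := fun a b => by simp [btmul, TensorProduct.tmul_add] }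

lemma tensorOfTuple_single {ι : Type u} {Y : Type u} [AddCommGroup Y] [Module Rᵐᵒᵖ Y]
    (π : (ι →₀ R) →ₗ[Rᵐᵒᵖ] Y) {M : Type w} [AddCommGroup M] [Module R M] (i : ι) (m : M) :
    tensorOfTuple π M (Finsupp.single i m) = btmul R (π (Finsupp.single i 1)) m := by
  rw [tensorOfTuple, Finsupp.liftAddHom_apply_single]
  rfl

lemma btmul_smul {Y : Type v} [AddCommGroup Y] [Module Rᵐᵒᵖ Y]
    {M : Type w} [AddCommGroup M] [Module R M] (y : Y) (r : R) (m : M) :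
    btmul R (MulOpposite.op r • y) m = btmul R y (r • m) := by
  rw [btmul, btmul, ← sub_eq_zero, ← map_sub, Submodule.mkQ_apply, Submodule.Quotient.mk_eq_zero]
  exact Submodule.subset_span ⟨y, r, m, rfl⟩

lemma btmul_add_left {Y : Type v} [AddCommGroup Y] [Module Rᵐᵒᵖ Y]
    {M : Type w} [AddCommGroup M] [Module R M] (y y' : Y) (m : M) :
    btmul R (y + y') m = btmul R y m + btmul R y' m := by
  simp [btmul, TensorProduct.add_tmul]

lemma btmul_sum_left {ι : Type*} (s : Finset ι) {Y : Type v} [AddCommGroup Y] [Module Rᵐᵒᵖ Y]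
    {M : Type w} [AddCommGroup M] [Module R M] (y : ι → Y) (m : M) :
    btmul R (∑ i ∈ s, y i) m = ∑ i ∈ s, btmul R (y i) m := by
  simp [btmul, TensorProduct.sum_tmul]

lemma btmul_zero_left {Y : Type v} [AddCommGroup Y] [Module Rᵐᵒᵖ Y]
    {M : Type w} [AddCommGroup M] [Module R M] (m : M) : btmul R (0 : Y) m = 0 := by
  simp [btmul]

lemma tensorOfTuple_smulTuple {ι : Type u} {Y : Type u} [AddCommGroup Y] [Module Rᵐᵒᵖ Y]
    (π : (ι →₀ R) →ₗ[Rᵐᵒᵖ] Y) {M : Type w} [AddCommGroup M] [Module R M] (k : ι →₀ R) (m : M) :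
    tensorOfTuple π M (smulTuple k m) = btmul R (π k) m := by
  induction k using Finsupp.induction_linear with
  | zero => simp [btmul_zero_left]
  | add k l hk hl => simp [hk, hl, btmul_add_left]
  | single i r =>
    have h1 : smulTuple (Finsupp.single i r) m = Finsupp.single i (r • m) := by
      simp [smulTuple]
    have h2 : (Finsupp.single i r : ι →₀ R) = MulOpposite.op r • Finsupp.single i 1 := by simp
    rw [h1, tensorOfTuple_single, h2, map_smul, btmul_smul]

lemma exists_balancedTensor_lift {Y : Type v} [AddCommGroup Y] [Module Rᵐᵒᵖ Y]
    {M : Type w} [AddCommGroup M] [Module R M] {T : Type*} [AddCommGroup T] (θ : Y →+ M →+ T)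
    (hθ : ∀ (y : Y) (r : R) (m : M), θ (MulOpposite.op r • y) m = θ y (r • m)) :
    ∃ Θ : BalancedTensor R Y M →+ T, ∀ y m, Θ (btmul R y m) = θ y m := by
  let F : Y →ₗ[ℤ] M →ₗ[ℤ] T :=
    LinearMap.mk₂ ℤ (fun y m => θ y m) (by simp) (by simp) (by simp) (by simp)
  let G : BalancedTensor R Y M →ₗ[ℤ] T :=
    (balancedRel R Y M).liftQ (TensorProduct.lift F) (by
      refine Submodule.span_le.2 ?_
      rintro _ ⟨y, r, m, rfl⟩
      exact (map_sub (TensorProduct.lift F) _ _).trans (sub_eq_zero.2 (hθ y r m)))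
  exact ⟨G.toAddMonoidHom, fun y m => rfl⟩

/-- The equational criterion for the vanishing of an element of a tensor product. -/
theorem exists_of_tensorOfTuple_eq_zero {ι : Type u} {Y : Type u} [AddCommGroup Y]
    [Module Rᵐᵒᵖ Y] (π : (ι →₀ R) →ₗ[Rᵐᵒᵖ] Y) (hπ : Function.Surjective π)
    {M : Type w} [AddCommGroup M] [Module R M] (t : ι →₀ M) (ht : tensorOfTuple π M t = 0) :
    ∃ (n : ℕ) (k : Fin n → ι →₀ R) (z : Fin n → M), (∀ l, π (k l) = 0) ∧
      ∑ l, smulTuple (k l) (z l) = t := by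
  -- `S` is to be the kernel of `tensorOfTuple π M`. A left inverse modulo `S` is `y ⊗ m ↦ c y • m`,
  -- with `c` a set-theoretic section of `π`; modulo `S` the choice of lift is irrelevant, so the
  -- formula is additive and balanced.
  let S : Submodule ℤ (ι →₀ M) :=
    Submodule.span ℤ {t | ∃ (k : ι →₀ R) (z : M), π k = 0 ∧ smulTuple k z = t}
  have hS : ∀ (k : ι →₀ R) (z : M), π k = 0 → S.mkQ (smulTuple k z) = 0 := fun k z hk =>
    (Submodule.Quotient.mk_eq_zero _).2 (Submodule.subset_span ⟨k, z, hk, rfl⟩)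
  obtain ⟨c, hc⟩ := hπ.hasRightInverse
  have hS' : ∀ (k k' : ι →₀ R) (z : M), π k = π k' →
      S.mkQ (smulTuple k z) = S.mkQ (smulTuple k' z) := fun k k' z h => by
    rw [← sub_eq_zero, ← map_sub, ← AddMonoidHom.sub_apply, ← map_sub]
    exact hS _ _ (by rw [map_sub, h, sub_self])
  let θ : Y →+ M →+ ((ι →₀ M) ⧸ S) := AddMonoidHom.mk'
    (fun y => S.mkQ.toAddMonoidHom.comp (smulTuple (c y))) (fun y y' => by
      ext m
      have := hS' (c (y + y')) (c y + c y') m (by simp [hc _])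
      simpa using this)
  have hθ : ∀ y m, θ y m = S.mkQ (smulTuple (c y) m) := fun _ _ => rfl
  obtain ⟨Θ, hΘ⟩ := exists_balancedTensor_lift θ (fun y (r : R) m => by
    have h1 : smulTuple (c y) (r • m) = smulTuple (MulOpposite.op r • c y) m := by
      ext i
      simp [smulTuple_apply, mul_smul]
    rw [hθ, hθ, h1]
    exact hS' _ _ m (by simp [hc _]))
  have hcomp : ∀ t, Θ (tensorOfTuple π M t) = S.mkQ t := fun t => by
    induction t using Finsupp.induction_linear with
    | zero => simp
    | add a b ha hb => rw [map_add, map_add, map_add, ha, hb]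
    | single i m =>
      rw [tensorOfTuple_single, hΘ, hθ, hS' _ (Finsupp.single i 1) m (hc _)]
      congr 1
      simp [smulTuple]
  have htS : t ∈ S := by
    rw [← Submodule.Quotient.mk_eq_zero, ← Submodule.mkQ_apply, ← hcomp, ht, map_zero]
  obtain ⟨n, a, g, hag⟩ := Submodule.mem_span_set'.1 htS
  choose k z hk hkz using fun l => (g l).2
  -- The integer coefficients of the span are absorbed into the relations.
  refine ⟨n, fun l => a l • k l, z, fun l => by rw [map_zsmul, hk, smul_zero], ?_⟩
  rw [← hag]
  refine Finset.sum_congr rfl fun l _ => ?_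
  rw [← hkz, map_zsmul]
  rfl

/-- The right linear map from the free right module on the set `Y` onto `Y`. -/
noncomputable def freeCover (R : Type u) [Ring R] (Y : Type u) [AddCommGroup Y] [Module Rᵐᵒᵖ Y] :
    (Y →₀ R) →ₗ[Rᵐᵒᵖ] Y :=
  Finsupp.lsum ℕ fun y =>
    { toFun := fun r => MulOpposite.op r • y
      map_add' := fun a b => by simp [add_smul]
      map_smul' := fun a b => by simp [mul_smul] }

lemma freeCover_single {Y : Type u} [AddCommGroup Y] [Module Rᵐᵒᵖ Y] (y : Y) (r : R) :
    freeCover R Y (Finsupp.single y r) = MulOpposite.op r • y := by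
  simp [freeCover]

lemma freeCover_surjective {Y : Type u} [AddCommGroup Y] [Module Rᵐᵒᵖ Y] :
    Function.Surjective (freeCover R Y) :=
  fun y => ⟨Finsupp.single y 1, by simp [freeCover_single]⟩

lemma tensorOfTuple_freeCover_surjective {Y : Type u} [AddCommGroup Y] [Module Rᵐᵒᵖ Y]
    {M : Type w} [AddCommGroup M] [Module R M] :
    Function.Surjective (tensorOfTuple (freeCover R Y) M) := by
  intro t
  obtain ⟨t, rfl⟩ := Submodule.mkQ_surjective _ t
  induction t using TensorProduct.induction_on with
  | zero => exact ⟨0, by simp⟩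
  | tmul y m =>
    refine ⟨Finsupp.single y m, ?_⟩
    rw [tensorOfTuple_single, freeCover_single]
    simp [btmul]
  | add a b ha hb =>
    obtain ⟨s, hs⟩ := ha
    obtain ⟨t, ht⟩ := hb
    exact ⟨s + t, by rw [map_add, hs, ht, map_add]⟩

lemma freeCover_mapDomain {X Y : Type u} [AddCommGroup X] [Module Rᵐᵒᵖ X] [AddCommGroup Y]
    [Module Rᵐᵒᵖ Y] (φ : X →ₗ[Rᵐᵒᵖ] Y) (k : X →₀ R) :
    freeCover R Y (k.mapDomain φ) = φ (freeCover R X k) := by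
  induction k using Finsupp.induction_linear with
  | zero => simp
  | add a b ha hb => simp [Finsupp.mapDomain_add, ha, hb]
  | single x r => simp [Finsupp.mapDomain_single, freeCover_single]

lemma btmap_tensorOfTuple_freeCover {X Y : Type u} [AddCommGroup X] [Module Rᵐᵒᵖ X]
    [AddCommGroup Y] [Module Rᵐᵒᵖ Y] (φ : X →ₗ[Rᵐᵒᵖ] Y) {M : Type w} [AddCommGroup M]
    [Module R M] (t : X →₀ M) :
    btmap φ M (tensorOfTuple (freeCover R X) M t) =
      tensorOfTuple (freeCover R Y) M (t.mapDomain φ) := by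
  induction t using Finsupp.induction_linear with
  | zero => simp
  | add a b ha hb => simp [Finsupp.mapDomain_add, ha, hb]
  | single x r =>
    simp [Finsupp.mapDomain_single, tensorOfTuple_single, freeCover_single, btmap_btmul]

end Vanishing

/-! ### Flatness and `𝔰`-torsion in terms of linear equations -/

section Flat

variable (R : Type u) [Ring R]

/-- Every solution of a finite homogeneous system of linear equations with coefficients in `R`
is a linear combination of solutions in `R`. -/
def EquationallyFlat (M : Type w) [AddCommGroup M] [Module R M] : Prop :=
  ∀ (m n : ℕ) (r : Fin m → Fin n → R) (x : Fin n → M), (∀ i, ∑ j, r i j • x j = 0) →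
    ∃ (p : ℕ) (c : Fin n → Fin p → R) (y : Fin p → M),
      (∀ j, x j = ∑ l, c j l • y l) ∧ ∀ i l, ∑ j, r i j * c j l = 0

variable {R}

lemma EquationallyFlat.of_finset {M : Type w} [AddCommGroup M] [Module R M]
    (hM : EquationallyFlat R M) {ι : Type*} (s : Finset ι) {n : ℕ} (r : ι → Fin n → R)
    (x : Fin n → M) (hx : ∀ i ∈ s, ∑ j, r i j • x j = 0) :
    ∃ (p : ℕ) (c : Fin n → Fin p → R) (y : Fin p → M),
      (∀ j, x j = ∑ l, c j l • y l) ∧ ∀ i ∈ s, ∀ l, ∑ j, r i j * c j l = 0 := by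
  obtain ⟨p, c, y, h1, h2⟩ := hM s.card n (fun i => r (s.equivFin.symm i)) x
    (fun i => hx _ (s.equivFin.symm i).2)
  exact ⟨p, c, y, h1, fun i hi l => by simpa using h2 (s.equivFin ⟨i, hi⟩) l⟩

lemma IsRelPure.of_finset {P : ℕ → ℕ → Prop} (hP : ∀ m n, P m n) {A : Type v} {B : Type w}
    [AddCommGroup A] [AddCommGroup B]
    [Module R A] [Module R B] {f : A →ₗ[R] B} (hf : IsRelPure P f) {ι : Type*} (s : Finset ι)
    {n : ℕ} (r : ι → Fin n → R) (a : ι → A) (x : Fin n → B)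
    (hx : ∀ i ∈ s, ∑ j, r i j • x j = f (a i)) :
    ∃ y : Fin n → A, ∀ i ∈ s, ∑ j, r i j • y j = a i := by
  obtain ⟨y, h⟩ := hf.2 s.card n (hP _ _) (fun i => r (s.equivFin.symm i))
    (fun i => a (s.equivFin.symm i)) ⟨x, fun i => hx _ (s.equivFin.symm i).2⟩
  exact ⟨y, fun i hi => by simpa using h (s.equivFin ⟨i, hi⟩)⟩

/-- The matrix `r` maps `R^n` onto a right submodule `X` of `R^m`. The tuple `x` gives an element of
`X ⊗ M` that dies in `R^m ⊗ M`, hence is zero by flatness; the vanishing criterion then writes `x`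
through elements of the kernel of the matrix. -/
theorem IsFlat.equationallyFlat {M : Type w} [AddCommGroup M] [Module R M] (hM : IsFlat R M) :
    EquationallyFlat R M := by
  intro m n r x hx
  let ι := ULift.{u} (Fin n)
  let e : (ι →₀ R) →ₗ[Rᵐᵒᵖ] (Fin m → R) :=
    { toFun := fun k i => ∑ j, r i j * k ⟨j⟩
      map_add' := fun a b => by ext; simp [mul_add, Finset.sum_add_distrib]
      map_smul' := fun a b => by ext; simp [Finset.sum_mul, mul_assoc] }
  let X := LinearMap.range e
  let t : ι →₀ M := Finsupp.equivFunOnFinite.symm fun j => x j.down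
  have ht : tensorOfTuple e.rangeRestrict M t = 0 := by
    apply hM _ _ X.subtype X.injective_subtype
    rw [map_zero]
    have h1 : ∀ t : ι →₀ M, btmap X.subtype M (tensorOfTuple e.rangeRestrict M t) =
        ∑ i, btmul R (Pi.single i 1 : Fin m → R) (∑ j, r i j • t ⟨j⟩) := fun t => by
      induction t using Finsupp.induction_linear with
      | zero => simp [btmul]
      | add a b ha hb =>
        rw [map_add, map_add, ha, hb, ← Finset.sum_add_distrib]
        refine Finset.sum_congr rfl fun i _ => ?_
        simp [btmul, TensorProduct.tmul_add, Finset.sum_add_distrib]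
      | single i x' =>
        have h2 : e (Finsupp.single i 1) =
            ∑ k, MulOpposite.op (r k i.down) • (Pi.single k 1 : Fin m → R) := by
          ext k
          rw [Finset.sum_apply]
          simp [e, ι, Finsupp.single_apply, ULift.ext_iff, Pi.single_apply]
        rw [tensorOfTuple_single, btmap_btmul]
        refine (congrArg (fun y => btmul R y x') h2).trans ?_
        rw [btmul_sum_left]
        refine Finset.sum_congr rfl fun k _ => ?_
        rw [btmul_smul]
        congr 1
        simp [ι, Finsupp.single_apply, ULift.ext_iff]
    rw [h1]
    refine Finset.sum_eq_zero fun i _ => ?_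
    have : ∑ j, r i j • t ⟨j⟩ = 0 := hx i
    rw [this]
    simp [btmul]
  obtain ⟨p, k, z, hk, hkz⟩ :=
    exists_of_tensorOfTuple_eq_zero _ e.surjective_rangeRestrict t ht
  refine ⟨p, fun j l => k l ⟨j⟩, z, fun j => ?_, fun i l => ?_⟩
  · have := DFunLike.congr_fun hkz ⟨j⟩
    rw [Finsupp.finsetSum_apply] at this
    exact this.symm
  · exact congrFun (congrArg Subtype.val (hk l)) i

theorem EquationallyFlat.isFlat {M : Type w} [AddCommGroup M] [Module R M]
    (hM : EquationallyFlat R M) : IsFlat R M := by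
  classical
  intro X Y _ _ _ _ φ hφ
  rw [injective_iff_map_eq_zero]
  intro t ht
  obtain ⟨t, rfl⟩ := tensorOfTuple_freeCover_surjective t
  rw [btmap_tensorOfTuple_freeCover] at ht
  obtain ⟨n, k, z, hk, hkz⟩ := exists_of_tensorOfTuple_eq_zero _ freeCover_surjective _ ht
  have hkz' : ∀ y, ∑ l, k l y • z l = t.mapDomain φ y := fun y => by
    rw [← hkz, Finsupp.finsetSum_apply]; rfl
  -- At coordinates outside the range of `φ` the pushed-forward tuple is zero, which is a finite
  -- homogeneous system for `z`. Factoring `z` through solutions in `R` gives new relations `k'`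
  -- supported on the range of `φ`; they pull back to relations in `X` because `φ` is injective.
  let U : Finset Y := (Finset.univ.biUnion fun l => (k l).support).filter (· ∉ Set.range φ)
  obtain ⟨p, c, w, hzw, hc⟩ := hM.of_finset U (fun y l => k l y) z (fun y hy => by
    rw [hkz', Finsupp.mapDomain_of_notMem_range _ _ (Finset.mem_filter.1 hy).2])
  let k' : Fin p → Y →₀ R := fun q => ∑ l, MulOpposite.op (c l q) • k l
  have hk' : ∀ q y, k' q y = ∑ l, k l y * c l q := fun q y => by
    simp [k', Finsupp.finsetSum_apply]
  have hsupp : ∀ q, ↑(k' q).support ⊆ Set.range φ := fun q y hy => by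
    by_contra hyr
    apply Finsupp.mem_support_iff.1 hy
    rw [hk']
    by_cases hyU : ∃ l, k l y ≠ 0
    · exact hc y (Finset.mem_filter.2 ⟨by simpa using hyU, hyr⟩) q
    · push Not at hyU
      simp [hyU]
  let κ : Fin p → X →₀ R := fun q => (k' q).comapDomain φ hφ.injOn
  have hκ : ∀ q, (κ q).mapDomain φ = k' q := fun q =>
    Finsupp.mapDomain_comapDomain _ hφ _ (hsupp q)
  have hκ0 : ∀ q, freeCover R X (κ q) = 0 := fun q => by
    apply hφ
    rw [← freeCover_mapDomain, hκ, map_zero, map_sum]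
    exact Finset.sum_eq_zero fun l _ => by rw [map_smul, hk, smul_zero]
  have htκ : t = ∑ q, smulTuple (κ q) (w q) := by
    ext x
    rw [Finsupp.finsetSum_apply, ← Finsupp.mapDomain_apply hφ t x, ← hkz']
    simp only [smulTuple_apply, κ, Finsupp.comapDomain_apply, hk', hzw, Finset.smul_sum,
      Finset.sum_smul, mul_smul]
    exact Finset.sum_comm
  rw [htκ, map_sum]
  exact Finset.sum_eq_zero fun q _ => by
    rw [tensorOfTuple_smulTuple, hκ0, btmul_zero_left]

theorem isFlat_iff_equationallyFlat {M : Type w} [AddCommGroup M] [Module R M] :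
    IsFlat R M ↔ EquationallyFlat R M :=
  ⟨IsFlat.equationallyFlat, EquationallyFlat.isFlat⟩

variable {P : ℕ → ℕ → Prop} {A B : Type w} [AddCommGroup A] [AddCommGroup B]
  [Module R A] [Module R B] {f : A →ₗ[R] B}

lemma IsFlat.of_isRelPure (hP : ∀ m n, P m n) (hf : IsRelPure P f) (hB : IsFlat R B) :
    IsFlat R A := by
  rw [isFlat_iff_equationallyFlat] at hB ⊢
  intro m n r x hx
  obtain ⟨p, c, y, hy, hc⟩ := hB m n r (fun j => f (x j)) (fun i => by
    simpa using congrArg f (hx i))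
  obtain ⟨y', hy'⟩ := hf.2 n p (hP _ _) c x ⟨y, fun j => (hy j).symm⟩
  exact ⟨p, c, y', fun j => (hy' j).symm, hc⟩

/-- Lift a solution in the quotient to `B`: its defects lie in the image of `A`, and purity corrects
the lift to a true solution, to which flatness of `B` applies. -/
lemma IsFlat.quotient_of_isRelPure (hP : ∀ m n, P m n) (hf : IsRelPure P f) (hB : IsFlat R B) :
    IsFlat R (B ⧸ LinearMap.range f) := by
  rw [isFlat_iff_equationallyFlat] at hB ⊢
  intro m n r x hx
  choose b hb using fun j => Submodule.mkQ_surjective _ (x j)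
  have hmem : ∀ i, ∃ a, f a = ∑ j, r i j • b j := fun i => by
    have : (LinearMap.range f).mkQ (∑ j, r i j • b j) = 0 := by
      simp only [map_sum, map_smul, hb, hx]
    rwa [Submodule.mkQ_apply, Submodule.Quotient.mk_eq_zero] at this
  choose a ha using hmem
  obtain ⟨a', ha'⟩ := hf.2 m n (hP _ _) r a ⟨b, fun i => (ha i).symm⟩
  obtain ⟨p, c, y, hy, hc⟩ := hB m n r (fun j => b j - f (a' j)) (fun i => by
    simp only [smul_sub, Finset.sum_sub_distrib, ← ha, ← ha', map_sum, map_smul, sub_self])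
  refine ⟨p, c, fun l => (LinearMap.range f).mkQ (y l), fun j => ?_, hc⟩
  have h0 : (LinearMap.range f).mkQ (f (a' j)) = 0 := by simp
  rw [← hb, ← sub_zero ((LinearMap.range f).mkQ (b j)), ← h0, ← map_sub, hy j]
  simp only [map_sum, map_smul]

/-- A solution `x` of a system with parameters in the kernel maps to a homogeneous solution in `B`.
Flatness factors this through solutions in `R`; lifting the factors to `A` gives a homogeneous
solution whose subtraction moves `x` into the kernel. -/
lemma IsFlat.isRelPure_ker_subtype {π : A →ₗ[R] B} (hB : IsFlat R B)
    (hπ : Function.Surjective π) : IsRelPure P (LinearMap.ker π).subtype := by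
  refine IsRelPureSubmodule.isRelPure_subtype ?_
  rintro m n - r a ha ⟨x, hx⟩
  obtain ⟨p, c, y, hy, hc⟩ := hB.equationallyFlat m n r (fun j => π (x j)) (fun i => by
    simpa [← hx] using ha i)
  choose y' hy' using fun l => hπ (y l)
  refine ⟨fun j => x j - ∑ l, c j l • y' l, fun j => ?_, fun i => ?_⟩
  · simp [hy', hy]
  · have : ∑ j, r i j • ∑ l, c j l • y' l = 0 := by
      simp only [Finset.smul_sum, smul_smul]
      rw [Finset.sum_comm]
      simp only [← Finset.sum_smul, hc, zero_smul, Finset.sum_const_zero]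
    simp only [smul_sub, Finset.sum_sub_distrib, hx, this, sub_zero]

/-- That `j 1 ⊗ f a` vanishes in `I ⊗ B` is witnessed by a finite system in `z` with parameters `f
a` and 0; purity solves it in `A`, giving `j 1 ⊗ a = 0`. -/
lemma IsSTorsion.of_isRelPure (hP : ∀ m n, P m n) (hf : IsRelPure P f) (hB : IsSTorsion R B) :
    IsSTorsion R A := by
  classical
  refine Set.eq_univ_of_forall fun a I _ _ hI j hj => ?_
  have hfa : f a ∈ sTorsion R B := hB ▸ Set.mem_univ _
  have h0 : tensorOfTuple (freeCover R I) B (Finsupp.single (j 1) (f a)) = 0 := by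
    rw [tensorOfTuple_single, freeCover_single, MulOpposite.op_one, one_smul, ← btmap_btmul]
    exact hfa I hI j hj
  obtain ⟨n, k, z, hk, hkz⟩ := exists_of_tensorOfTuple_eq_zero _ freeCover_surjective _ h0
  have hsingle : ∀ y, Finsupp.single (j 1) (f a) y = f (Finsupp.single (j 1) a y) := fun y => by
    simp only [Finsupp.single_apply]; split <;> simp
  have hkz' : ∀ y, ∑ l, k l y • z l = f (Finsupp.single (j 1) a y) := fun y => by
    rw [← hsingle, ← hkz, Finsupp.finsetSum_apply]; rfl
  obtain ⟨z', hz'⟩ := hf.of_finset hP (Finset.univ.biUnion fun l => (k l).support)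
    (fun y l => k l y) (fun y => Finsupp.single (j 1) a y) z (fun y _ => hkz' y)
  have : Finsupp.single (j 1) a = ∑ l, smulTuple (k l) (z' l) := by
    ext y
    rw [Finsupp.finsetSum_apply]
    -- Only coordinates in the supports entered the system; elsewhere the equation over `B` reads `0
    -- = f (…)`, and injectivity of `f` suffices.
    by_cases hy : ∃ l, k l y ≠ 0
    · exact (hz' y (by simpa using hy)).symm
    · push Not at hy
      apply hf.1
      rw [← hkz']
      simp [smulTuple_apply, hy]
  have h1 : tensorOfTuple (freeCover R I) A (Finsupp.single (j 1) a) = 0 := by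
    rw [this, map_sum]
    exact Finset.sum_eq_zero fun l _ => by
      rw [tensorOfTuple_smulTuple, hk, btmul_zero_left]
  rw [tensorOfTuple_single, freeCover_single, MulOpposite.op_one, one_smul] at h1
  rw [btmap_btmul, h1]

end Flat

end RelInj
namespace RelInj

/-! ### The three kinds of embedding as relative purity -/

section Embeddings

variable {R : Type u} [Ring R] {A : Type v} {B : Type w} [AddCommGroup A] [AddCommGroup B]
  [Module R A] [Module R B] {f : A →ₗ[R] B}

lemma isRelPure_false_iff : IsRelPure (fun _ _ => False) f ↔ Function.Injective f :=
  ⟨fun h => h.1, fun h => ⟨h, fun _ _ h => h.elim⟩⟩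

lemma isRelPure_true_iff : IsRelPure (fun _ _ => True) f ↔ IsPureEmbedding f := by
  refine and_congr_right fun hf => ?_
  have h : ∀ (m n : ℕ) (r : Fin m → Fin n → R) (y : Fin n → A) (a : Fin m → A) (i : Fin m),
      ∑ j, r i j • f (y j) = f (a i) ↔ ∑ j, r i j • y j = a i := fun m n r y a i => by
    rw [← hf.eq_iff]; simp
  simp only [true_implies, h]

lemma isRelPure_one_iff : IsRelPure (fun m n => m = 1 ∧ n = 1) f ↔ IsRDEmbedding f := by
  refine and_congr_right fun hf => ⟨fun h r => ?_, ?_⟩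
  · refine Set.Subset.antisymm ?_ ?_
    · rintro _ ⟨⟨a, rfl⟩, b, hb⟩
      obtain ⟨y, hy⟩ := h 1 1 ⟨rfl, rfl⟩ (fun _ _ => r) (fun _ => a) ⟨fun _ => b, by simpa using hb⟩
      refine ⟨f (y 0), ⟨_, rfl⟩, ?_⟩
      have := hy 0
      simp only [Finset.univ_unique, Fin.default_eq_zero, Finset.sum_singleton] at this
      simp [← this]
    · rintro _ ⟨_, ⟨a, rfl⟩, rfl⟩
      exact ⟨⟨r • a, by simp⟩, f a, rfl⟩
  · rintro h _ _ ⟨rfl, rfl⟩ r a ⟨x, hx⟩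
    obtain ⟨_, ⟨y, rfl⟩, hy⟩ : f (a 0) ∈ (fun b : B => r 0 0 • b) '' Set.range f := by
      rw [← h]
      exact ⟨⟨_, rfl⟩, x 0, by simpa using hx 0⟩
    refine ⟨fun _ => y, fun i => hf ?_⟩
    rw [Subsingleton.elim i 0]
    simpa using hy

end Embeddings

/-! ### Cotorsion modules as relative injectives -/

section Cotorsion

open CategoryTheory Abelian

variable {R : Type u} [Ring R]

/-- Expand each `x j` in the standard basis; each coordinate of a solution is itself a solution in
`R`. -/
lemma isFlat_finsupp (ι : Type w) : IsFlat R (ι →₀ R) := by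
  classical
  refine EquationallyFlat.isFlat fun m n r x hx => ?_
  let s : Finset ι := Finset.univ.biUnion fun j => (x j).support
  refine ⟨s.card, fun j l => x j (s.equivFin.symm l),
    fun l => Finsupp.single (s.equivFin.symm l : ι) 1, fun j => ?_, fun i l => ?_⟩
  · rw [s.equivFin.symm.sum_comp (fun i : s => x j i • Finsupp.single (i : ι) (1 : R)),
      Finset.sum_coe_sort s (fun i => x j i • Finsupp.single i (1 : R))]
    conv_lhs => rw [← (x j).sum_single]
    rw [Finsupp.sum_of_support_subset (s := s) _ ?_ _ (by simp)]
    · simp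
    · exact Finset.subset_biUnion_of_mem (fun j => (x j).support) (Finset.mem_univ j)
  · simpa [Finsupp.finsetSum_apply] using DFunLike.congr_fun (hx i) (s.equivFin.symm l : ι)

variable {C : Type (max u v)} [AddCommGroup C] [Module R C]

lemma exists_extension_of_subsingleton_ext {A B : Type (max u v)} [AddCommGroup A]
    [AddCommGroup B] [Module R A] [Module R B] (f : A →ₗ[R] B) (hf : Function.Injective f)
    (hC : Subsingleton (Ext (ModuleCat.of R (B ⧸ LinearMap.range f)) (ModuleCat.of R C) 1))
    (g : A →ₗ[R] C) : ∃ h : B →ₗ[R] C, h ∘ₗ f = g := by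
  let S : ShortComplex (ModuleCat.{max u v} R) :=
    ShortComplex.mk (ModuleCat.ofHom f) (ModuleCat.ofHom (LinearMap.range f).mkQ) (by
      ext; simp)
  have hS : S.ShortExact := ModuleCat.shortComplex_shortExact S
    (LinearMap.exact_iff.2 (Submodule.ker_mkQ _)) hf (Submodule.mkQ_surjective _)
  obtain ⟨x, hx⟩ := Ext.contravariant_sequence_exact₁ hS (ModuleCat.of R C)
    (Ext.mk₀ (ModuleCat.ofHom g)) (add_zero 1) (hC.elim _ _)
  obtain ⟨h, rfl⟩ := (Ext.mk₀_bijective _ _).2 x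
  rw [Ext.mk₀_comp_mk₀] at hx
  exact ⟨h.hom, congrArg ModuleCat.Hom.hom ((Ext.mk₀_bijective _ _).1 hx)⟩

/-- As `F` is projective, every class in `Ext¹(G, C)` is the connecting image of a map from the
kernel of `π`; a map that extends to `F` has connecting image zero. -/
lemma subsingleton_ext_of_exists_extension {G F : Type (max u v)} [AddCommGroup G]
    [AddCommGroup F] [Module R G] [Module R F] [Module.Projective R F] (π : F →ₗ[R] G)
    (hπ : Function.Surjective π)
    (h : ∀ g : LinearMap.ker π →ₗ[R] C, ∃ h : F →ₗ[R] C, h ∘ₗ (LinearMap.ker π).subtype = g) :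
    Subsingleton (Ext (ModuleCat.of R G) (ModuleCat.of R C) 1) := by
  refine subsingleton_of_forall_eq 0 fun x => ?_
  have hS := LinearMap.shortExact_shortComplexKer hπ
  obtain ⟨y, rfl⟩ := Ext.contravariant_sequence_exact₃ hS (ModuleCat.of R C) x
    (Ext.eq_zero_of_projective _) (add_zero 1)
  obtain ⟨g, rfl⟩ := (Ext.mk₀_bijective _ _).2 y
  obtain ⟨k, hk⟩ := h g.hom
  have : g = π.shortComplexKer.f ≫ ModuleCat.ofHom k := by
    ext x
    exact (LinearMap.congr_fun hk x).symm
  rw [this, ← Ext.mk₀_comp_mk₀, ← Ext.comp_assoc _ _ _ (add_zero 1) (add_zero 0) (by simp),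
    hS.extClass_comp, Ext.zero_comp]

/-- Pure embeddings into flat modules have flat cokernels; conversely, a flat module is the quotient
of a free, hence flat, module by a pure submodule. -/
lemma isCotorsion_iff_exists_extension : IsCotorsion R C ↔
    ∀ (A B : Type (max u v)) [AddCommGroup A] [AddCommGroup B] [Module R A] [Module R B],
      IsFlat R B → ∀ f : A →ₗ[R] B, IsPureEmbedding f →
        ∀ g : A →ₗ[R] C, ∃ h : B →ₗ[R] C, h ∘ₗ f = g := by
  refine ⟨fun hC A B _ _ _ _ hB f hf g => ?_, fun h G _ _ hG => ?_⟩
  · exact exists_extension_of_subsingleton_ext f hf.1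
      (hC _ (hB.quotient_of_isRelPure (fun _ _ => trivial) (isRelPure_true_iff.2 hf))) g
  · let π : (G →₀ R) →ₗ[R] G := Finsupp.linearCombination R id
    have hπ : Function.Surjective π := Finsupp.linearCombination_id_surjective R G
    exact subsingleton_ext_of_exists_extension π hπ
      (h _ _ (isFlat_finsupp G) _ (isRelPure_true_iff.1 (hG.isRelPure_ker_subtype hπ)))

end Cotorsion

end RelInj

/-! ### The five characterizations -/

theorem mainTheorem6 (R : Type u) [Ring R] :
    -- (1) injective modules
    (∀ (E : Type (max u v)) [AddCommGroup E] [Module R E],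
      Module.Injective R E ↔
        ∀ (A B : Type (max u v)) [AddCommGroup A] [AddCommGroup B] [Module R A] [Module R B]
          (f : A →ₗ[R] B), Function.Injective f →
          #A ≤ Cardinal.lift.{v} #R + ℵ₀ → #B ≤ Cardinal.lift.{v} #R + ℵ₀ →
          ∀ g : A →ₗ[R] E, ∃ h : B →ₗ[R] E, h ∘ₗ f = g) ∧
    -- (2) RD-injective modules
    (∀ (E : Type (max u v)) [AddCommGroup E] [Module R E],
      IsRDInjective R E ↔
        ∀ (A B : Type (max u v)) [AddCommGroup A] [AddCommGroup B] [Module R A] [Module R B]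
          (f : A →ₗ[R] B), IsRDEmbedding f →
          #A ≤ Cardinal.lift.{v} #R + ℵ₀ → #B ≤ Cardinal.lift.{v} #R + ℵ₀ →
          ∀ g : A →ₗ[R] E, ∃ h : B →ₗ[R] E, h ∘ₗ f = g) ∧
    -- (3) pure-injective modules
    (∀ (E : Type (max u v)) [AddCommGroup E] [Module R E],
      IsPureInjective R E ↔
        ∀ (A B : Type (max u v)) [AddCommGroup A] [AddCommGroup B] [Module R A] [Module R B]
          (f : A →ₗ[R] B), IsPureEmbedding f →
          #A ≤ Cardinal.lift.{v} #R + ℵ₀ → #B ≤ Cardinal.lift.{v} #R + ℵ₀ →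
          ∀ g : A →ₗ[R] E, ∃ h : B →ₗ[R] E, h ∘ₗ f = g) ∧
    -- (4) flat cotorsion modules
    (∀ (F : Type (max u v)) [AddCommGroup F] [Module R F], IsFlat R F →
      (IsCotorsion R F ↔
        ∀ (A B : Type (max u v)) [AddCommGroup A] [AddCommGroup B] [Module R A] [Module R B],
          IsFlat R A → IsFlat R B → ∀ f : A →ₗ[R] B, IsPureEmbedding f →
          #A ≤ Cardinal.lift.{v} #R + ℵ₀ → #B ≤ Cardinal.lift.{v} #R + ℵ₀ →
          ∀ g : A →ₗ[R] F, ∃ h : B →ₗ[R] F, h ∘ₗ f = g)) ∧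
    -- (5) pure-injective modules relative to the 𝔰-torsion modules
    (∀ (T : Type (max u v)) [AddCommGroup T] [Module R T], IsSTorsion R T →
      (IsSTorPureInjective R T ↔
        ∀ (A B : Type (max u v)) [AddCommGroup A] [AddCommGroup B] [Module R A] [Module R B],
          IsSTorsion R A → IsSTorsion R B → ∀ f : A →ₗ[R] B, IsPureEmbedding f →
          #A ≤ Cardinal.lift.{v} #R + ℵ₀ → #B ≤ Cardinal.lift.{v} #R + ℵ₀ →
          ∀ g : A →ₗ[R] T, ∃ h : B →ₗ[R] T, h ∘ₗ f = g)) := by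
  refine ⟨fun E _ _ => ⟨fun h A B _ _ _ _ f hf _ _ g => ?_, fun h => ⟨fun A B _ _ _ _ f hf g => ?_⟩⟩,
    fun E _ _ => ⟨fun h A B _ _ _ _ f hf _ _ g => h A B f hf g,
      fun h A B _ _ _ _ f hf g => ?_⟩,
    fun E _ _ => ⟨fun h A B _ _ _ _ f hf _ _ g => h A B f hf g,
      fun h A B _ _ _ _ f hf g => ?_⟩,
    fun F _ _ _ => ?_,
    fun T _ _ hT => ⟨fun h A B _ _ _ _ hA hB f hf _ _ g => h.2 A B hA hB f hf g,
      fun h => ⟨hT, fun A B _ _ _ _ _ hB f hf g => ?_⟩⟩⟩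
  · obtain ⟨k, hk⟩ := h.out f hf g
    exact ⟨k, LinearMap.ext hk⟩
  · obtain ⟨k, hk⟩ := exists_extension_of_small.{u, v} _ (fun _ _ _ => True)
      (fun _ _ _ _ _ _ _ _ _ => trivial) E
      (fun A B _ _ _ _ _ _ f hf => h A B f (isRelPure_false_iff.1 hf)) A B trivial f
      (isRelPure_false_iff.2 hf) g
    exact ⟨k, LinearMap.congr_fun hk⟩
  · exact exists_extension_of_small.{u, v} _ (fun _ _ _ => True)
      (fun _ _ _ _ _ _ _ _ _ => trivial) E
      (fun A B _ _ _ _ _ _ f hf => h A B f (isRelPure_one_iff.1 hf)) A B trivial f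
      (isRelPure_one_iff.2 hf) g
  · exact exists_extension_of_small.{u, v} _ (fun _ _ _ => True)
      (fun _ _ _ _ _ _ _ _ _ => trivial) E
      (fun A B _ _ _ _ _ _ f hf => h A B f (isRelPure_true_iff.1 hf)) A B trivial f
      (isRelPure_true_iff.2 hf) g
  · rw [isCotorsion_iff_exists_extension.{u, v}]
    refine ⟨fun h A B _ _ _ _ _ hB f hf _ _ g => h A B hB f hf g,
      fun h A B _ _ _ _ hB f hf g => ?_⟩
    exact exists_extension_of_small.{u, v} _ (fun M _ _ => IsFlat R M)
      (fun _ _ _ _ _ _ _ hf hB => hB.of_isRelPure (fun _ _ => trivial) hf) F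
      (fun A B _ _ _ _ hA hB f hf => h A B hA hB f (isRelPure_true_iff.1 hf)) A B hB f
      (isRelPure_true_iff.2 hf) g
  · exact exists_extension_of_small.{u, v} _ (fun M _ _ => IsSTorsion R M)
      (fun _ _ _ _ _ _ _ hf hB => hB.of_isRelPure (fun _ _ => trivial) hf) T
      (fun A B _ _ _ _ hA hB f hf => h A B hA hB f (isRelPure_true_iff.1 hf)) A B hB f
      (isRelPure_true_iff.2 hf) g
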